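/- Let $n\ge 1$, $1<p<\infty$ and $0\le\lambda<n$. For a measurable $f:\mathbb{R}^n\to\mathbb{C}$, $x\in\mathbb{R}^n$ and $r>0$ put $$\mathfrak{M}_{p,\lambda}(f;x,r)=\frac1{r^{\lambda}}\int_{B(x,r)}|f(y)|^p\,dy ,\qquad \|f\|_{p,\lambda}=\sup_{x\in\mathbb{R}^n,\,r>0}\mathfrak{M}_{p,\lambda}(f;x,r)^{1/p},$$ and let $L^{p,\lambda}(\mathbb{R}^n)$ be the Morrey space of all $f$ with $\|f\|_{p,\lambda}<\infty$. Let $V^{(*)}_{0,\infty}L^{p,\lambda}(\mathbb{R}^n)$ be the subspace, with the same norm, of all $f\in L^{p,\lambda}(\mathbb{R}^n)$ such that $$\lim_{r\to0}\sup_{x\in\mathbb{R}^n}\mathfrak{M}_{p,\lambda}(f;x,r)=0,\qquad \lim_{r\to\infty}\sup_{x\in\mathbb{R}^n}\mathfrak{M}_{p,\lambda}(f;x,r)=0,\qquad \lim_{N\to\infty}\sup_{x\in\mathbb{R}^n}\int_{B(x,1)\setminus B(0,N)}|f(y)|^p\,dy=0 .$$ Let $K:\mathbb{R}^n\times\mathbb{R}^n\to\mathbb{C}$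 be a measurable kernel such that $|K(x,y)|\le c\,|x-y|^{-n}$ for all $x\ne y$, with a constant $c$ independent of $x$ and $y$, and let $S$ be the singular integral operator $$Sf(x)=\lim_{\varepsilon\to0^+}\int_{|x-y|>\varepsilon}K(x,y)f(y)\,dy .$$ Assume that $S$ is bounded in $L^p(\mathbb{R}^n)$, that is, for every $f\in L^p(\mathbb{R}^n)$ the limit exists for almost every $x$, and $\|Sf\|_{L^p}\le A\|f\|_{L^p}$ with a constant $A$ independent of $f$. Then $S$ is bounded from $V^{(*)}_{0,\infty}L^{p,\lambda}(\mathbb{R}^n)$ into itself: there is a constant $C$ such that for every $f\in V^{(*)}_{0,\infty}L^{p,\lambda}(\mathbb{R}^n)$ the integrals $\int_{|x-y|>\varepsilon}K(x,y)f(y)\,dy$, $\varepsilon>0$, converge absolutely and have a limit $Sf(x)$ as $\varepsilon\to0^+$ for almost every $x\in\mathbb{R}^n$, $Sf\in V^{(*)}_{0,\infty}L^{p,\lambda}(\mathbb{R}^n)$, and $\|Sf\|_{p,\lambda}\le C\|f\|_{p,\lambda}$. -/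

import Mathlib

open MeasureTheory Filter Topology Set
open scoped ENNReal NNReal

noncomputable section

namespace VanishingMorrey

variable {n : ℕ}

/-- The Morrey modular `r ^ (-lam) * ∫_{B(x,r)} |f|^p` (used for `r > 0`), with values in `[0, ∞]`. -/
def modular (p lam : ℝ) (f : EuclideanSpace ℝ (Fin n) → ℂ)
    (x : EuclideanSpace ℝ (Fin n)) (r : ℝ) : ℝ≥0∞ :=
  (∫⁻ y in Metric.ball x r, ‖f y‖ₑ ^ p) / ENNReal.ofReal (r ^ lam)

/-- The Morrey norm, with values in `[0, ∞]`. -/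
def morreyNorm (p lam : ℝ) (f : EuclideanSpace ℝ (Fin n) → ℂ) : ℝ≥0∞ :=
  ⨆ (x : EuclideanSpace ℝ (Fin n)) (r : ℝ) (_ : 0 < r), modular p lam f x r ^ (1 / p)

/-- Membership in the Morrey space. For `0 < p`, finiteness of the norm includes that `f` is
`p`-integrable on every ball. -/
def MemMorrey (p lam : ℝ) (f : EuclideanSpace ℝ (Fin n) → ℂ) : Prop :=
  AEStronglyMeasurable f volume ∧ morreyNorm p lam f < ∞

/-- The vanishing property at the origin. -/
def VanishesAtZero (p lam : ℝ) (f : EuclideanSpace ℝ (Fin n) → ℂ) : Prop :=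
  Tendsto (fun r : ℝ => ⨆ x : EuclideanSpace ℝ (Fin n), modular p lam f x r) (𝓝[>] 0) (𝓝 0)

/-- The vanishing property at infinity. -/
def VanishesAtInfty (p lam : ℝ) (f : EuclideanSpace ℝ (Fin n) → ℂ) : Prop :=
  Tendsto (fun r : ℝ => ⨆ x : EuclideanSpace ℝ (Fin n), modular p lam f x r) atTop (𝓝 0)

/-- The quantity `sup_x ∫_{B(x,1)} |f(y)|^p χ_{ℝⁿ ∖ B(0,N)}(y) dy`. -/
def truncModular (p : ℝ) (f : EuclideanSpace ℝ (Fin n) → ℂ) (N : ℕ) : ℝ≥0∞ :=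
  ⨆ x : EuclideanSpace ℝ (Fin n), ∫⁻ y in Metric.ball x 1,
    (Metric.ball (0 : EuclideanSpace ℝ (Fin n)) (N : ℝ))ᶜ.indicator (fun z => ‖f z‖ₑ ^ p) y

/-- The vanishing property under truncation to the complement of large balls. -/
def VanishesStar (p : ℝ) (f : EuclideanSpace ℝ (Fin n) → ℂ) : Prop :=
  Tendsto (fun N : ℕ => truncModular p f N) atTop (𝓝 0)

/-- Membership in `V₀L^{p,lam}`. -/
def MemVZero (p lam : ℝ) (f : EuclideanSpace ℝ (Fin n) → ℂ) : Prop :=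
  MemMorrey p lam f ∧ VanishesAtZero p lam f

/-- Membership in `V_∞L^{p,lam}`. -/
def MemVInfty (p lam : ℝ) (f : EuclideanSpace ℝ (Fin n) → ℂ) : Prop :=
  MemMorrey p lam f ∧ VanishesAtInfty p lam f

/-- Membership in `V^{(*)}L^{p,lam}`. -/
def MemVStar (p lam : ℝ) (f : EuclideanSpace ℝ (Fin n) → ℂ) : Prop :=
  MemMorrey p lam f ∧ VanishesStar p f

/-- Membership in the intersection of the three vanishing Morrey subspaces. -/
def MemVZeroInftyStar (p lam : ℝ) (f : EuclideanSpace ℝ (Fin n) → ℂ) : Prop :=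
  MemVZero p lam f ∧ MemVInfty p lam f ∧ MemVStar p lam f

/-- The truncated integral `∫_{|x-y|>ε} K(x,y) f(y) dy`. -/
def truncatedIntegral (K : EuclideanSpace ℝ (Fin n) → EuclideanSpace ℝ (Fin n) → ℂ)
    (f : EuclideanSpace ℝ (Fin n) → ℂ) (x : EuclideanSpace ℝ (Fin n)) (ε : ℝ) : ℂ :=
  ∫ y in {y | ε < ‖x - y‖}, K x y * f y

/-- The singular integral of `f` exists at `x`: the truncated integrals converge absolutely and
have a limit as `ε → 0+`. -/
def SingularIntegralExists (K : EuclideanSpace ℝ (Fin n) → EuclideanSpace ℝ (Fin n) → ℂ)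
    (f : EuclideanSpace ℝ (Fin n) → ℂ) (x : EuclideanSpace ℝ (Fin n)) : Prop :=
  (∀ ε : ℝ, 0 < ε → IntegrableOn (fun y => K x y * f y) {y | ε < ‖x - y‖} volume) ∧
    ∃ L : ℂ, Tendsto (truncatedIntegral K f x) (𝓝[>] 0) (𝓝 L)

/-- The singular integral `Sf(x) = lim_{ε → 0+} ∫_{|x-y|>ε} K(x,y) f(y) dy`; it is meaningful at
the points where `SingularIntegralExists K f x`. -/
def singularIntegral (K : EuclideanSpace ℝ (Fin n) → EuclideanSpace ℝ (Fin n) → ℂ)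
    (f : EuclideanSpace ℝ (Fin n) → ℂ) (x : EuclideanSpace ℝ (Fin n)) : ℂ :=
  limUnder (𝓝[>] 0) (truncatedIntegral K f x)

/-- The singular integral operator with kernel `K` is well defined (almost everywhere) on the
function space with membership predicate `X`, maps it into itself, and is bounded with respect to
the norm `N`. -/
def SingularIntegralBoundedOn (K : EuclideanSpace ℝ (Fin n) → EuclideanSpace ℝ (Fin n) → ℂ)
    (X : (EuclideanSpace ℝ (Fin n) → ℂ) → Prop)
    (N : (EuclideanSpace ℝ (Fin n) → ℂ) → ℝ≥0∞) : Prop :=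
  ∃ C : ℝ≥0, ∀ f : EuclideanSpace ℝ (Fin n) → ℂ, X f →
    (∀ᵐ x, SingularIntegralExists K f x) ∧ X (singularIntegral K f) ∧
      N (singularIntegral K f) ≤ C * N f

end VanishingMorrey

end

/-!
The operator is controlled by a pointwise comparison of modulars. Write `M(f; x, r)` for the Morrey
modular and `q = 2 ^ ((lam - n) / p)`, which is less than `1`. The local estimate
`exists_modular_singularIntegral_le` says that

  `M(Sf; x, r) ^ (1 / p) ≤ C * ∑ k, q ^ k * M(f; x, 2 ^ k r) ^ (1 / p)`

with `C` independent of `f`, `x` and `r`. To prove it, `f` is cut at `B(x, 2r)`. The inner part lies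
in `L^p` and is handled by the boundedness of `S` there. The outer part contributes, on `B(x, r)`,
an absolutely convergent integral which is the same for all truncations `ε < r`
(`singularIntegral_split`); the size of the kernel and Hölder's inequality on the dyadic shells
around `x` bound it by the sum above (`lintegral_compl_ball_le`). The same splitting gives the
existence of `Sf` almost everywhere.

Since `q < 1`, the norm inequality follows by summing a geometric series. Each vanishing property
passes from `f` to `Sf` by dominated convergence in the sum over `k`: the first two because the
limits `r → 0` and `r → ∞` are insensitive to replacing `r` by `2 ^ k r`
(`tendsto_iSup_modular_zero`), the third because for fixed `k` the ball `B(x, 2 ^ k)` is covered by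
boundedly many unit balls, all of which move to infinity with `x`
(`tendsto_iSup_modular_far`, `VanishesStar.of_modular_le`).
-/

namespace VanishingMorrey

variable {n : ℕ} {p lam : ℝ}

/-! ### Morrey modulars at dyadic radii -/

lemma lintegral_ball_rpow_eq (hp : 0 < p) (f : EuclideanSpace ℝ (Fin n) → ℂ)
    (x : EuclideanSpace ℝ (Fin n)) {r : ℝ} (hr : 0 < r) :
    (∫⁻ y in Metric.ball x r, ‖f y‖ₑ ^ p) ^ (1 / p) =
      ENNReal.ofReal (r ^ (lam / p)) * modular p lam f x r ^ (1 / p) := by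
  have h1 : ENNReal.ofReal (r ^ (lam / p)) = ENNReal.ofReal (r ^ lam) ^ (1 / p) := by
    rw [ENNReal.ofReal_rpow_of_pos (by positivity), ← Real.rpow_mul hr.le]
    congr 2; ring
  have h2 : ENNReal.ofReal (r ^ lam) ≠ 0 := by
    rw [Ne, ENNReal.ofReal_eq_zero, not_le]; positivity
  rw [h1, ← ENNReal.mul_rpow_of_nonneg _ _ (by positivity), modular,
    ENNReal.mul_div_cancel h2 ENNReal.ofReal_ne_top]

lemma modular_rpow_le_morreyNorm (f : EuclideanSpace ℝ (Fin n) → ℂ)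
    (x : EuclideanSpace ℝ (Fin n)) {r : ℝ} (hr : 0 < r) :
    modular p lam f x r ^ (1 / p) ≤ morreyNorm p lam f :=
  le_iSup_of_le x <| le_iSup_of_le r <| le_iSup_of_le hr le_rfl

/-- A function of finite Morrey norm is `p`-integrable on every ball. -/
lemma lintegral_ball_lt_top (hp : 0 < p) {f : EuclideanSpace ℝ (Fin n) → ℂ}
    (hf : morreyNorm p lam f < ∞) (x : EuclideanSpace ℝ (Fin n)) {r : ℝ} (hr : 0 < r) :
    (∫⁻ y in Metric.ball x r, ‖f y‖ₑ ^ p) ^ (1 / p) < ∞ := by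
  rw [lintegral_ball_rpow_eq (lam := lam) hp f x hr]
  exact ENNReal.mul_lt_top ENNReal.ofReal_lt_top
    ((modular_rpow_le_morreyNorm f x hr).trans_lt hf)

/-- The ratio `2 ^ ((lam - n) / p)`, by which the weights of consecutive dyadic shells decrease. -/
noncomputable def dyadicRatio (n : ℕ) (p lam : ℝ) : ℝ≥0∞ :=
  ENNReal.ofReal (2 ^ ((lam - n) / p))

lemma dyadicRatio_lt_one (hp : 0 < p) (hlam : lam < n) : dyadicRatio n p lam < 1 := by
  rw [dyadicRatio, ENNReal.ofReal_lt_one]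
  exact Real.rpow_lt_one_of_one_lt_of_neg one_lt_two (div_neg_of_neg_of_pos (by linarith) hp)

lemma tsum_dyadicRatio_ne_top (hp : 0 < p) (hlam : lam < n) :
    ∑' k : ℕ, dyadicRatio n p lam ^ k ≠ ∞ := by
  rw [ENNReal.tsum_geometric, Ne, ENNReal.inv_eq_top, tsub_eq_zero_iff_le, not_le]
  exact dyadicRatio_lt_one hp hlam

/-- The geometrically weighted sum of the Morrey modulars of `f` over the dyadic dilates of the
ball `B(x, r)`. It controls the singular integral of `f` on that ball. -/
noncomputable def dyadicSum (p lam : ℝ) (f : EuclideanSpace ℝ (Fin n) → ℂ)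
    (x : EuclideanSpace ℝ (Fin n)) (r : ℝ) : ℝ≥0∞ :=
  ∑' k : ℕ, dyadicRatio n p lam ^ k * modular p lam f x (2 ^ k * r) ^ (1 / p)

lemma dyadicSum_le (f : EuclideanSpace ℝ (Fin n) → ℂ) (x : EuclideanSpace ℝ (Fin n)) {r : ℝ}
    (hr : 0 < r) :
    dyadicSum p lam f x r ≤ (∑' k : ℕ, dyadicRatio n p lam ^ k) * morreyNorm p lam f := by
  rw [dyadicSum, ← ENNReal.tsum_mul_right]
  gcongr with k
  exact modular_rpow_le_morreyNorm f x (by positivity)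

lemma dyadicSum_lt_top (hp : 0 < p) (hlam : lam < n) {f : EuclideanSpace ℝ (Fin n) → ℂ}
    (hf : morreyNorm p lam f < ∞) (x : EuclideanSpace ℝ (Fin n)) {r : ℝ} (hr : 0 < r) :
    dyadicSum p lam f x r < ∞ :=
  (dyadicSum_le f x hr).trans_lt
    (ENNReal.mul_lt_top (tsum_dyadicRatio_ne_top hp hlam).lt_top hf)

/-! ### The far part of the integral -/

/-- Hölder's inequality on a ball, in terms of the Morrey modular. -/
lemma lintegral_ball_enorm_le (hp : 1 < p) {f : EuclideanSpace ℝ (Fin n) → ℂ}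
    (hf : AEStronglyMeasurable f volume) (x : EuclideanSpace ℝ (Fin n)) {r : ℝ} (hr : 0 < r) :
    ∫⁻ y in Metric.ball x r, ‖f y‖ₑ ≤
      ENNReal.ofReal (r ^ (n + (lam - n) / p)) *
        volume (Metric.ball (0 : EuclideanSpace ℝ (Fin n)) 1) ^ (1 - 1 / p) *
        modular p lam f x r ^ (1 / p) := by
  have hpq := Real.HolderConjugate.conjExponent hp
  have hp0 : 0 < p := by linarith
  have hq : 1 / p.conjExponent = 1 - 1 / p := by
    have := hpq.inv_add_inv_eq_one
    simp only [one_div]; linarith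
  have h := ENNReal.lintegral_mul_le_Lp_mul_Lq (volume.restrict (Metric.ball x r)) hpq
    (f := fun y => ‖f y‖ₑ) (g := fun _ => 1) hf.restrict.enorm aemeasurable_const
  simp only [Pi.mul_apply, mul_one, ENNReal.one_rpow, lintegral_one, Measure.restrict_apply_univ]
    at h
  refine h.trans (le_of_eq ?_)
  have h1p : 0 ≤ 1 - 1 / p := by
    rw [sub_nonneg, div_le_one hp0]; exact hp.le
  rw [lintegral_ball_rpow_eq (lam := lam) hp0 f x hr, hq, Measure.addHaar_ball_of_pos _ _ hr,
    ENNReal.mul_rpow_of_nonneg _ _ h1p, ENNReal.ofReal_rpow_of_pos (by positivity),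
    finrank_euclideanSpace_fin]
  have : r ^ ((n : ℝ) + (lam - n) / p) = r ^ (lam / p) * (r ^ n) ^ (1 - 1 / p) := by
    rw [← Real.rpow_natCast, ← Real.rpow_mul hr.le, ← Real.rpow_add hr]
    congr 1; field_simp; ring
  rw [this, ENNReal.ofReal_mul (by positivity)]
  ring

lemma compl_ball_subset_iUnion_annuli (x : EuclideanSpace ℝ (Fin n)) {r : ℝ} (hr : 0 < r) :
    (Metric.ball x (2 * r))ᶜ ⊆
      ⋃ k : ℕ, Metric.ball x (2 ^ (k + 2) * r) \ Metric.ball x (2 ^ (k + 1) * r) := by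
  intro y hy
  rw [mem_compl_iff, Metric.mem_ball, not_lt] at hy
  obtain ⟨k, hk1, hk2⟩ := exists_nat_pow_near (x := dist y x / (2 * r)) (y := (2 : ℝ))
    ((one_le_div (by positivity)).2 hy) one_lt_two
  rw [le_div_iff₀ (by positivity)] at hk1
  rw [div_lt_iff₀ (by positivity)] at hk2
  refine mem_iUnion.2 ⟨k, ?_, ?_⟩
  · rw [Metric.mem_ball]; refine hk2.trans_eq (by ring)
  · rw [Metric.mem_ball, not_lt]; refine le_trans (le_of_eq (by ring)) hk1

/-- The contribution of the complement of `B(x₀, 2r)` to the integral of `|K(x, ·) f|` at a point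
`x ∈ B(x₀, r)`. On the shell `2 ^ (k + 1) r ≤ |y - x₀| < 2 ^ (k + 2) r` one has
`|x - y| ≥ 2 ^ k r`, and Hölder's inequality bounds the integral of `|f|`. -/
lemma lintegral_compl_ball_le (hp : 1 < p)
    {K : EuclideanSpace ℝ (Fin n) → EuclideanSpace ℝ (Fin n) → ℂ} {c : ℝ} (hc : 0 ≤ c)
    (hK : ∀ x y : EuclideanSpace ℝ (Fin n), x ≠ y → ‖K x y‖ ≤ c / ‖x - y‖ ^ n)
    {f : EuclideanSpace ℝ (Fin n) → ℂ} (hf : AEStronglyMeasurable f volume)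
    {x₀ x : EuclideanSpace ℝ (Fin n)} {r : ℝ} (hr : 0 < r) (hx : x ∈ Metric.ball x₀ r) :
    ∫⁻ y in (Metric.ball x₀ (2 * r))ᶜ, ‖K x y * f y‖ₑ ≤
      ENNReal.ofReal (c * 4 ^ n) *
        volume (Metric.ball (0 : EuclideanSpace ℝ (Fin n)) 1) ^ (1 - 1 / p) *
        ENNReal.ofReal (r ^ ((lam - n) / p)) * dyadicSum p lam f x₀ r := by
  have hp0 : 0 < p := by linarith
  have shell : ∀ k : ℕ,
      ∫⁻ y in Metric.ball x₀ (2 ^ (k + 2) * r) \ Metric.ball x₀ (2 ^ (k + 1) * r),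
        ‖K x y * f y‖ₑ ≤
      ENNReal.ofReal (c * 4 ^ n) *
        volume (Metric.ball (0 : EuclideanSpace ℝ (Fin n)) 1) ^ (1 - 1 / p) *
        ENNReal.ofReal (r ^ ((lam - n) / p)) *
        (dyadicRatio n p lam ^ (k + 2) * modular p lam f x₀ (2 ^ (k + 2) * r) ^ (1 / p)) := by
    intro k
    have hR : 0 < 2 ^ (k + 2) * r := by positivity
    set R := 2 ^ (k + 2) * r with hRdef
    have hpt : ∀ y ∈ Metric.ball x₀ R \ Metric.ball x₀ (2 ^ (k + 1) * r),
        ‖K x y * f y‖ₑ ≤ ENNReal.ofReal (c * 4 ^ n / R ^ n) * ‖f y‖ₑ := by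
      rintro y ⟨-, hy⟩
      rw [Metric.mem_ball, not_lt] at hy
      rw [Metric.mem_ball] at hx
      have h2k : (1 : ℝ) ≤ 2 ^ k := one_le_pow₀ one_le_two
      have hdist : R / 4 ≤ ‖x - y‖ := by
        have htri := dist_triangle y x x₀
        rw [dist_comm y x, dist_eq_norm x y] at htri
        have e1 : R / 4 = 2 ^ k * r := by rw [hRdef]; ring
        have e2 : (2 : ℝ) ^ (k + 1) * r = 2 ^ k * r + 2 ^ k * r := by ring
        nlinarith
      have hne : x ≠ y := by
        rintro rfl
        simp only [sub_self, norm_zero] at hdist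
        linarith
      rw [enorm_mul]
      gcongr
      rw [← ofReal_norm]
      refine ENNReal.ofReal_le_ofReal ((hK x y hne).trans ?_)
      have e3 : c * 4 ^ n / R ^ n = c / (R / 4) ^ n := by
        rw [div_pow, div_div_eq_mul_div]
      rw [e3]
      gcongr
    calc _ ≤ ∫⁻ y in Metric.ball x₀ R \ Metric.ball x₀ (2 ^ (k + 1) * r),
              ENNReal.ofReal (c * 4 ^ n / R ^ n) * ‖f y‖ₑ :=
            setLIntegral_mono' (measurableSet_ball.diff measurableSet_ball) hpt
      _ ≤ ∫⁻ y in Metric.ball x₀ R, ENNReal.ofReal (c * 4 ^ n / R ^ n) * ‖f y‖ₑ :=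
            lintegral_mono_set sdiff_subset
      _ = ENNReal.ofReal (c * 4 ^ n / R ^ n) * ∫⁻ y in Metric.ball x₀ R, ‖f y‖ₑ :=
            lintegral_const_mul' _ _ ENNReal.ofReal_ne_top
      _ ≤ _ := mul_le_mul_right (lintegral_ball_enorm_le (lam := lam) hp hf x₀ hR) _
      _ = _ := by
        have e4 : ENNReal.ofReal (c * 4 ^ n / R ^ n) *
            ENNReal.ofReal (R ^ (n + (lam - n) / p)) =
            ENNReal.ofReal (c * 4 ^ n) * ENNReal.ofReal (r ^ ((lam - n) / p)) *
              dyadicRatio n p lam ^ (k + 2) := by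
          rw [dyadicRatio, ← ENNReal.ofReal_pow (by positivity),
            ← ENNReal.ofReal_mul (by positivity), ← ENNReal.ofReal_mul (by positivity),
            ← ENNReal.ofReal_mul (by positivity), Real.rpow_add hR, Real.rpow_natCast]
          congr 1
          rw [← Real.rpow_natCast (2 ^ ((lam - n) / p)), ← Real.rpow_mul zero_le_two,
            mul_comm ((lam - n) / p), Real.rpow_mul zero_le_two, Real.rpow_natCast, mul_assoc,
            ← Real.mul_rpow hr.le (by positivity), mul_comm r]
          rw [← hRdef]
          field_simp
        rw [← mul_assoc, ← mul_assoc, e4]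
        ring
  refine (lintegral_mono_set (compl_ball_subset_iUnion_annuli x₀ hr)).trans
    ((lintegral_iUnion_le _ _).trans ((ENNReal.tsum_le_tsum shell).trans ?_))
  rw [ENNReal.tsum_mul_left, dyadicSum]
  exact mul_le_mul_right (ENNReal.tsum_comp_le_tsum_of_injective (add_left_injective 2)
    (fun k => dyadicRatio n p lam ^ k * modular p lam f x₀ (2 ^ k * r) ^ (1 / p))) _

/-! ### Local splitting of the singular integral -/

lemma measurableSet_lt_norm_sub (x : EuclideanSpace ℝ (Fin n)) (ε : ℝ) :
    MeasurableSet {y : EuclideanSpace ℝ (Fin n) | ε < ‖x - y‖} :=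
  measurableSet_lt measurable_const (by fun_prop)

/-- At a point `x ∈ B(x₀, r)` the part of `f` outside `B(x₀, 2r)` contributes to every truncated
integral with `ε < r` the same absolutely convergent integral. -/
lemma singularIntegral_split {K : EuclideanSpace ℝ (Fin n) → EuclideanSpace ℝ (Fin n) → ℂ}
    {f : EuclideanSpace ℝ (Fin n) → ℂ} (hf : AEStronglyMeasurable f volume)
    {x₀ x : EuclideanSpace ℝ (Fin n)} {r : ℝ} (hx : x ∈ Metric.ball x₀ r)
    (hKx : AEStronglyMeasurable (K x) volume)
    (hfar : ∫⁻ y in (Metric.ball x₀ (2 * r))ᶜ, ‖K x y * f y‖ₑ < ∞)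
    (hloc : SingularIntegralExists K ((Metric.ball x₀ (2 * r)).indicator f) x) :
    SingularIntegralExists K f x ∧
      ‖singularIntegral K f x‖ₑ ≤
        ‖singularIntegral K ((Metric.ball x₀ (2 * r)).indicator f) x‖ₑ +
          ∫⁻ y in (Metric.ball x₀ (2 * r))ᶜ, ‖K x y * f y‖ₑ := by
  have hr : 0 < r := Metric.pos_of_mem_ball hx
  set B := Metric.ball x₀ (2 * r)
  have hB : MeasurableSet Bᶜ := measurableSet_ball.compl
  have hint : IntegrableOn (fun y => K x y * f y) Bᶜ volume := ⟨(hKx.mul hf).restrict, hfar⟩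
  have hint' : Integrable (fun y => K x y * Bᶜ.indicator f y) volume := by
    refine (hint.integrable_indicator hB).congr (Eventually.of_forall fun y => ?_)
    exact indicator_mul_right _ (K x) f
  have hsum : ∀ y, K x y * f y = K x y * B.indicator f y + K x y * Bᶜ.indicator f y := by
    intro y
    rw [← mul_add, ← Pi.add_apply, indicator_self_add_compl]
  obtain ⟨habs, L, hL⟩ := hloc
  have hfull : ∀ ε : ℝ, 0 < ε →
      IntegrableOn (fun y => K x y * f y) {y | ε < ‖x - y‖} volume := by
    intro ε hε
    have := (habs ε hε).add (hint'.integrableOn (s := {y | ε < ‖x - y‖}))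
    exact this.congr (Eventually.of_forall fun y => (hsum y).symm)
  have hsub : ∀ ε < r, Bᶜ ⊆ {y | ε < ‖x - y‖} := by
    intro ε hε y hy
    rw [mem_compl_iff, Metric.mem_ball, not_lt] at hy
    rw [Metric.mem_ball] at hx
    have htri := dist_triangle y x x₀
    rw [dist_comm y x, dist_eq_norm x y] at htri
    simp only [mem_ofPred_eq]
    linarith
  have htrunc : ∀ᶠ ε in 𝓝[>] (0 : ℝ),
      truncatedIntegral K (B.indicator f) x ε + ∫ y in Bᶜ, K x y * f y =
        truncatedIntegral K f x ε := by
    filter_upwards [Ioo_mem_nhdsGT hr] with ε hε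
    have e1 : ∫ y in {y | ε < ‖x - y‖}, K x y * Bᶜ.indicator f y = ∫ y in Bᶜ, K x y * f y := by
      simp only [← indicator_mul_right (s := Bᶜ) (K x)]
      rw [setIntegral_indicator hB, inter_eq_right.2 (hsub ε hε.2)]
    rw [truncatedIntegral, truncatedIntegral, ← e1,
      ← integral_add (habs ε hε.1) hint'.integrableOn]
    exact integral_congr_ae (Eventually.of_forall fun y => (hsum y).symm)
  have hlim : Tendsto (truncatedIntegral K f x) (𝓝[>] 0) (𝓝 (L + ∫ y in Bᶜ, K x y * f y)) :=
    (hL.add_const _).congr' htrunc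
  refine ⟨⟨hfull, _, hlim⟩, ?_⟩
  rw [singularIntegral, singularIntegral, hlim.limUnder_eq, hL.limUnder_eq]
  exact (enorm_add_le _ _).trans (add_le_add le_rfl (enorm_integral_le_lintegral_enorm _))

lemma aestronglyMeasurable_truncatedIntegral
    {K : EuclideanSpace ℝ (Fin n) → EuclideanSpace ℝ (Fin n) → ℂ}
    (hK : AEStronglyMeasurable
      (fun z : EuclideanSpace ℝ (Fin n) × EuclideanSpace ℝ (Fin n) => K z.1 z.2)
      (volume.prod volume))
    {f : EuclideanSpace ℝ (Fin n) → ℂ} (hf : AEStronglyMeasurable f volume) (ε : ℝ) :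
    AEStronglyMeasurable (fun x => truncatedIntegral K f x ε) volume := by
  have hs : MeasurableSet
      {z : EuclideanSpace ℝ (Fin n) × EuclideanSpace ℝ (Fin n) | ε < ‖z.1 - z.2‖} :=
    measurableSet_lt measurable_const (by fun_prop)
  refine ((hK.mul hf.comp_snd).indicator hs).integral_prod_right'.congr
    (Eventually.of_forall fun x => ?_)
  simp only [truncatedIntegral]
  rw [← integral_indicator (measurableSet_lt_norm_sub x ε)]
  rfl

lemma aestronglyMeasurable_singularIntegral
    {K : EuclideanSpace ℝ (Fin n) → EuclideanSpace ℝ (Fin n) → ℂ}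
    (hK : AEStronglyMeasurable
      (fun z : EuclideanSpace ℝ (Fin n) × EuclideanSpace ℝ (Fin n) => K z.1 z.2)
      (volume.prod volume))
    {f : EuclideanSpace ℝ (Fin n) → ℂ} (hf : AEStronglyMeasurable f volume)
    (hex : ∀ᵐ x, SingularIntegralExists K f x) :
    AEStronglyMeasurable (singularIntegral K f) volume := by
  refine aestronglyMeasurable_of_tendsto_ae (𝓝[>] (0 : ℝ))
    (fun ε => aestronglyMeasurable_truncatedIntegral hK hf ε) ?_
  filter_upwards [hex] with x hx
  exact tendsto_nhds_limUnder hx.2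

lemma eLpNorm_indicator_ball (hp : 0 < p) (f : EuclideanSpace ℝ (Fin n) → ℂ)
    (x : EuclideanSpace ℝ (Fin n)) (r : ℝ) :
    eLpNorm ((Metric.ball x r).indicator f) (ENNReal.ofReal p) volume =
      (∫⁻ y in Metric.ball x r, ‖f y‖ₑ ^ p) ^ (1 / p) := by
  rw [eLpNorm_indicator_eq_eLpNorm_restrict measurableSet_ball,
    eLpNorm_eq_lintegral_rpow_enorm_toReal (by simpa using hp) ENNReal.ofReal_ne_top,
    ENNReal.toReal_ofReal hp.le]

/-- The local estimate behind the theorem: on each ball `B(x, r)` the singular integral of a Morrey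
function exists almost everywhere, and its modular is controlled by the modulars of `f` over the
dyadic dilates of the ball, with geometrically decreasing weights. -/
theorem exists_modular_singularIntegral_le (hp : 1 < p) (hlam : lam < n)
    {K : EuclideanSpace ℝ (Fin n) → EuclideanSpace ℝ (Fin n) → ℂ}
    (hK_meas : AEStronglyMeasurable
      (fun z : EuclideanSpace ℝ (Fin n) × EuclideanSpace ℝ (Fin n) => K z.1 z.2)
      (volume.prod volume))
    (hK_size : ∃ c : ℝ, ∀ x y : EuclideanSpace ℝ (Fin n), x ≠ y → ‖K x y‖ ≤ c / ‖x - y‖ ^ n)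
    (hK_Lp : SingularIntegralBoundedOn K
      (fun f => MemLp f (ENNReal.ofReal p) volume)
      (fun f => eLpNorm f (ENNReal.ofReal p) volume)) :
    ∃ C : ℝ≥0∞, C ≠ ∞ ∧ ∀ f : EuclideanSpace ℝ (Fin n) → ℂ, MemMorrey p lam f →
      (∀ᵐ x, SingularIntegralExists K f x) ∧
      ∀ (x : EuclideanSpace ℝ (Fin n)) (r : ℝ), 0 < r →
        modular p lam (singularIntegral K f) x r ^ (1 / p) ≤ C * dyadicSum p lam f x r := by
  have hp0 : 0 < p := by linarith
  obtain ⟨c, hc, hKc⟩ : ∃ c : ℝ, 0 ≤ c ∧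
      ∀ x y : EuclideanSpace ℝ (Fin n), x ≠ y → ‖K x y‖ ≤ c / ‖x - y‖ ^ n := by
    obtain ⟨c, hc⟩ := hK_size
    refine ⟨max c 0, le_max_right _ _, fun x y hxy => (hc x y hxy).trans ?_⟩
    gcongr
    exact le_max_left _ _
  obtain ⟨A, hA⟩ := hK_Lp
  have hKx := hK_meas.prodMk_left
  set V := volume (Metric.ball (0 : EuclideanSpace ℝ (Fin n)) 1)
  have hV : V ≠ ∞ := measure_ball_lt_top.ne
  have h1p : 0 ≤ 1 - 1 / p := by rw [sub_nonneg, div_le_one hp0]; exact hp.le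
  -- the constant in the bound of the far part
  set C₀ := ENNReal.ofReal (c * 4 ^ n) * V ^ (1 - 1 / p)
  have hC₀ : C₀ ≠ ∞ :=
    ENNReal.mul_ne_top ENNReal.ofReal_ne_top (ENNReal.rpow_ne_top_of_nonneg h1p hV)
  have key : ∀ f : EuclideanSpace ℝ (Fin n) → ℂ, MemMorrey p lam f →
      ∀ (x₀ : EuclideanSpace ℝ (Fin n)) (r : ℝ), 0 < r →
      MemLp ((Metric.ball x₀ (2 * r)).indicator f) (ENNReal.ofReal p) volume ∧
      ∀ᵐ x, x ∈ Metric.ball x₀ r → SingularIntegralExists K f x ∧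
        ‖singularIntegral K f x‖ₑ ≤
          ‖singularIntegral K ((Metric.ball x₀ (2 * r)).indicator f) x‖ₑ +
            C₀ * ENNReal.ofReal (r ^ ((lam - n) / p)) * dyadicSum p lam f x₀ r := by
    intro f hf x₀ r hr
    have hmem : MemLp ((Metric.ball x₀ (2 * r)).indicator f) (ENNReal.ofReal p) volume := by
      refine ⟨hf.1.indicator measurableSet_ball, ?_⟩
      rw [eLpNorm_indicator_ball hp0]
      exact lintegral_ball_lt_top hp0 hf.2 x₀ (by positivity)
    refine ⟨hmem, ?_⟩
    filter_upwards [hKx, (hA _ hmem).1] with x hx1 hx2 hx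
    have hfar := lintegral_compl_ball_le (lam := lam) hp hc hKc hf.1 hr hx
    have hfin : ∫⁻ y in (Metric.ball x₀ (2 * r))ᶜ, ‖K x y * f y‖ₑ < ∞ :=
      hfar.trans_lt (ENNReal.mul_lt_top (ENNReal.mul_lt_top hC₀.lt_top ENNReal.ofReal_lt_top)
        (dyadicSum_lt_top hp0 hlam hf.2 x₀ hr))
    obtain ⟨h1, h2⟩ := singularIntegral_split hf.1 hx hx1 hfin hx2
    exact ⟨h1, h2.trans (add_le_add le_rfl hfar)⟩
  refine ⟨A * ENNReal.ofReal (2 ^ ((n : ℝ) / p)) + C₀ * V ^ (1 / p), ?_, fun f hf => ⟨?_, ?_⟩⟩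
  · exact ENNReal.add_ne_top.2 ⟨ENNReal.mul_ne_top ENNReal.coe_ne_top ENNReal.ofReal_ne_top,
      ENNReal.mul_ne_top hC₀ (ENNReal.rpow_ne_top_of_nonneg (by positivity) hV)⟩
  · have hall : ∀ᵐ x : EuclideanSpace ℝ (Fin n), ∀ m : ℕ,
        x ∈ Metric.ball 0 ((m : ℝ) + 1) → SingularIntegralExists K f x :=
      ae_all_iff.2 fun m => (key f hf 0 (m + 1) (by positivity)).2.mono
        fun x hx hxm => (hx hxm).1
    filter_upwards [hall] with x hx
    obtain ⟨m, hm⟩ := exists_nat_gt ‖x‖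
    exact hx m (by rw [mem_ball_zero_iff]; linarith)
  · intro x₀ r hr
    obtain ⟨hmem, hae⟩ := key f hf x₀ r hr
    obtain ⟨-, hSmem, hSle⟩ := hA _ hmem
    beta_reduce at hSmem hSle
    set g := singularIntegral K ((Metric.ball x₀ (2 * r)).indicator f)
    set D := dyadicSum p lam f x₀ r
    set T := C₀ * ENNReal.ofReal (r ^ ((lam - n) / p)) * D with hT
    have hlocal : (∫⁻ y in Metric.ball x₀ r, ‖g y‖ₑ ^ p) ^ (1 / p) ≤
        A * (ENNReal.ofReal (2 ^ ((n : ℝ) / p)) * ENNReal.ofReal (r ^ (lam / p)) * D) := by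
      calc _ ≤ (∫⁻ y, ‖g y‖ₑ ^ p) ^ (1 / p) := by
            gcongr
            exact Measure.restrict_le_self
        _ = eLpNorm g (ENNReal.ofReal p) volume := by
            rw [eLpNorm_eq_lintegral_rpow_enorm_toReal (by simpa using hp0)
              ENNReal.ofReal_ne_top, ENNReal.toReal_ofReal hp0.le]
        _ ≤ A * eLpNorm ((Metric.ball x₀ (2 * r)).indicator f) (ENNReal.ofReal p) volume := hSle
        _ ≤ _ := by
            rw [eLpNorm_indicator_ball hp0,
              lintegral_ball_rpow_eq (lam := lam) hp0 f x₀ (by positivity : 0 < 2 * r)]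
            refine mul_le_mul_right ?_ _
            -- the ball `B(x₀, 2r)` is the term `k = 1` of the dyadic sum
            have hterm : dyadicRatio n p lam * modular p lam f x₀ (2 * r) ^ (1 / p) ≤ D := by
              have := ENNReal.le_tsum (f := fun k : ℕ =>
                dyadicRatio n p lam ^ k * modular p lam f x₀ (2 ^ k * r) ^ (1 / p)) 1
              rwa [pow_one, pow_one] at this
            have e1 : ENNReal.ofReal ((2 * r) ^ (lam / p)) =
                ENNReal.ofReal (2 ^ ((n : ℝ) / p)) * ENNReal.ofReal (r ^ (lam / p)) *
                  dyadicRatio n p lam := by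
              rw [dyadicRatio, ← ENNReal.ofReal_mul (by positivity),
                ← ENNReal.ofReal_mul (by positivity), Real.mul_rpow zero_le_two hr.le]
              congr 1
              have : (2 : ℝ) ^ (lam / p) = 2 ^ ((n : ℝ) / p) * 2 ^ ((lam - n) / p) := by
                rw [← Real.rpow_add two_pos]; congr 1; ring
              rw [this]; ring
            rw [e1, mul_assoc]
            exact mul_le_mul_right hterm _
    have hfar : (∫⁻ _ in Metric.ball x₀ r, T ^ p) ^ (1 / p) =
        C₀ * V ^ (1 / p) * ENNReal.ofReal (r ^ (lam / p)) * D := by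
      have e2 : ENNReal.ofReal (r ^ ((lam - n) / p)) *
          ENNReal.ofReal (r ^ Module.finrank ℝ (EuclideanSpace ℝ (Fin n))) ^ (1 / p) =
          ENNReal.ofReal (r ^ (lam / p)) := by
        rw [ENNReal.ofReal_rpow_of_pos (by positivity), ← ENNReal.ofReal_mul (by positivity),
          finrank_euclideanSpace_fin, ← Real.rpow_natCast, ← Real.rpow_mul hr.le,
          ← Real.rpow_add hr]
        congr 2; ring
      rw [setLIntegral_const, Measure.addHaar_ball_of_pos _ _ hr,
        ENNReal.mul_rpow_of_nonneg _ _ (by positivity : 0 ≤ 1 / p), ← ENNReal.rpow_mul,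
        mul_one_div_cancel hp0.ne', ENNReal.rpow_one,
        ENNReal.mul_rpow_of_nonneg _ _ (by positivity : 0 ≤ 1 / p), hT, ← e2]
      ring
    have hmink : (∫⁻ y in Metric.ball x₀ r, ‖singularIntegral K f y‖ₑ ^ p) ^ (1 / p) ≤
        ENNReal.ofReal (r ^ (lam / p)) *
          ((A * ENNReal.ofReal (2 ^ ((n : ℝ) / p)) + C₀ * V ^ (1 / p)) * D) := by
      calc _ ≤ (∫⁻ y in Metric.ball x₀ r,
              ((fun y => ‖g y‖ₑ) + fun _ => T : EuclideanSpace ℝ (Fin n) → ℝ≥0∞) y ^ p) ^ (1 / p) := by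
            gcongr 1
            refine lintegral_mono_ae ?_
            rw [ae_restrict_iff' measurableSet_ball]
            filter_upwards [hae] with y hy hyB
            exact ENNReal.rpow_le_rpow (hy hyB).2 hp0.le
        _ ≤ _ := ENNReal.lintegral_Lp_add_le hSmem.1.restrict.enorm aemeasurable_const hp.le
        _ ≤ _ := add_le_add hlocal hfar.le
        _ = _ := by ring
    rw [lintegral_ball_rpow_eq (lam := lam) hp0 _ x₀ hr] at hmink
    refine (ENNReal.mul_le_mul_iff_right ?_ ENNReal.ofReal_ne_top).1 hmink
    rw [Ne, ENNReal.ofReal_eq_zero, not_le]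
    positivity

/-! ### Passing vanishing properties through the dyadic sum -/

/-- Dominated convergence for series with summable weights. -/
lemma tendsto_tsum_mul_zero {ι : Type*} {l : Filter ι} [l.IsCountablyGenerated]
    {w : ℕ → ℝ≥0∞} (hw : ∑' k, w k ≠ ∞) {φ : ℕ → ι → ℝ≥0∞} {M : ℝ≥0∞} (hM : M ≠ ∞)
    (hφM : ∀ᶠ i in l, ∀ k, φ k i ≤ M) (hφ : ∀ k, Tendsto (φ k) l (𝓝 0)) :
    Tendsto (fun i => ∑' k, w k * φ k i) l (𝓝 0) := by
  have h := tendsto_lintegral_filter_of_dominated_convergence (μ := Measure.count) (l := l)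
    (F := fun i k => w k * φ k i) (f := fun _ => 0) (fun k => w k * M)
    (Eventually.of_forall fun _ => measurable_of_countable _)
    (hφM.mono fun i hi => Eventually.of_forall fun k => mul_le_mul_right (hi k) _)
    (by rw [lintegral_count, ENNReal.tsum_mul_right]; exact ENNReal.mul_ne_top hw hM)
    (Eventually.of_forall fun k => by
      have := ENNReal.Tendsto.const_mul (hφ k)
        (Or.inr (ENNReal.ne_top_of_tsum_ne_top hw k))
      rwa [mul_zero] at this)
  simpa only [lintegral_count, tsum_zero] using h

lemma tendsto_rpow_const_zero {ι : Type*} {l : Filter ι} {φ : ι → ℝ≥0∞} {s : ℝ} (hs : 0 < s)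
    (hφ : Tendsto φ l (𝓝 0)) : Tendsto (fun i => φ i ^ s) l (𝓝 0) := by
  have := hφ.ennrpow_const s
  rwa [ENNReal.zero_rpow_of_pos hs] at this

lemma iSup_modular_rpow_le_morreyNorm (hp : 0 < p) (f : EuclideanSpace ℝ (Fin n) → ℂ) {r : ℝ}
    (hr : 0 < r) :
    (⨆ x : EuclideanSpace ℝ (Fin n), modular p lam f x r) ^ (1 / p) ≤ morreyNorm p lam f := by
  rw [one_div, ENNReal.rpow_inv_le_iff hp]
  refine iSup_le fun x => ?_
  rw [← ENNReal.rpow_inv_le_iff hp, ← one_div]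
  exact modular_rpow_le_morreyNorm f x hr

/-- The vanishing of the modulars, uniformly in the centre, is inherited along every filter on the
radii that is stable under dyadic dilations; it is used for `r → 0` and for `r → ∞`. -/
lemma tendsto_iSup_modular_zero (hp : 0 < p) (hlam : lam < n)
    {f g : EuclideanSpace ℝ (Fin n) → ℂ} (hf : morreyNorm p lam f < ∞) {C : ℝ≥0∞} (hC : C ≠ ∞)
    (hfg : ∀ (x : EuclideanSpace ℝ (Fin n)) (r : ℝ), 0 < r →
      modular p lam g x r ^ (1 / p) ≤ C * dyadicSum p lam f x r)
    {l : Filter ℝ} [l.IsCountablyGenerated] (hpos : ∀ᶠ r in l, 0 < r)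
    (hdil : ∀ k : ℕ, Tendsto (fun r : ℝ => 2 ^ k * r) l l)
    (hvan : Tendsto (fun r : ℝ => ⨆ x : EuclideanSpace ℝ (Fin n), modular p lam f x r) l (𝓝 0)) :
    Tendsto (fun r : ℝ => ⨆ x : EuclideanSpace ℝ (Fin n), modular p lam g x r) l (𝓝 0) := by
  have h1 : Tendsto (fun r : ℝ => ∑' k : ℕ, dyadicRatio n p lam ^ k *
      (⨆ x : EuclideanSpace ℝ (Fin n), modular p lam f x (2 ^ k * r)) ^ (1 / p)) l (𝓝 0) := by
    refine tendsto_tsum_mul_zero (tsum_dyadicRatio_ne_top hp hlam) hf.ne ?_ fun k => ?_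
    · filter_upwards [hpos] with r hr k
      exact iSup_modular_rpow_le_morreyNorm hp f (by positivity)
    · exact tendsto_rpow_const_zero (by positivity) (hvan.comp (hdil k))
  have h2 := ENNReal.Tendsto.const_mul h1 (Or.inr hC)
  rw [mul_zero] at h2
  replace h2 := tendsto_rpow_const_zero hp h2
  refine tendsto_of_tendsto_of_tendsto_of_le_of_le' tendsto_const_nhds h2
    (Eventually.of_forall fun _ => zero_le) ?_
  filter_upwards [hpos] with r hr
  refine iSup_le fun x => ?_
  rw [← ENNReal.rpow_inv_le_iff hp, ← one_div]
  refine (hfg x r hr).trans (mul_le_mul_right (ENNReal.tsum_le_tsum fun k => ?_) _)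
  gcongr
  exact le_iSup (fun x : EuclideanSpace ℝ (Fin n) => modular p lam f x (2 ^ k * r)) x

/-- A ball of radius `R` is covered by a number of unit balls depending only on `R`, so its mass is
controlled by `truncModular` as soon as it does not meet `B(0, N)`. -/
lemma exists_lintegral_ball_le_truncModular (n : ℕ) (p R : ℝ) :
    ∃ m : ℕ, ∀ (f : EuclideanSpace ℝ (Fin n) → ℂ) (x : EuclideanSpace ℝ (Fin n)) (N : ℕ),
      (∀ y ∈ Metric.ball x R, (N : ℝ) ≤ ‖y‖) →
        ∫⁻ y in Metric.ball x R, ‖f y‖ₑ ^ p ≤ m * truncModular p f N := by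
  obtain ⟨t, -, htfin, ht⟩ :=
    (isCompact_closedBall (0 : EuclideanSpace ℝ (Fin n)) R).finite_cover_balls one_pos
  lift t to Finset (EuclideanSpace ℝ (Fin n)) using htfin
  refine ⟨t.card, fun f x N hN => ?_⟩
  have hcov : Metric.ball x R ⊆ ⋃ c : t, Metric.ball (x + c) 1 := by
    intro y hy
    have hy' : y - x ∈ Metric.closedBall (0 : EuclideanSpace ℝ (Fin n)) R := by
      rw [mem_closedBall_zero_iff, ← dist_eq_norm]
      exact (Metric.mem_ball.1 hy).le
    obtain ⟨c, hc, hyc⟩ := mem_iUnion₂.1 (ht hy')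
    refine mem_iUnion.2 ⟨⟨c, hc⟩, ?_⟩
    rw [Metric.mem_ball, dist_eq_norm] at hyc ⊢
    rwa [← sub_sub]
  set F : EuclideanSpace ℝ (Fin n) → ℝ≥0∞ :=
    (Metric.ball (0 : EuclideanSpace ℝ (Fin n)) (N : ℝ))ᶜ.indicator (fun z => ‖f z‖ₑ ^ p)
  calc ∫⁻ y in Metric.ball x R, ‖f y‖ₑ ^ p = ∫⁻ y in Metric.ball x R, F y := by
        refine setLIntegral_congr_fun measurableSet_ball fun y hy => ?_
        refine (indicator_of_mem ?_ (fun z => ‖f z‖ₑ ^ p)).symm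
        rw [mem_compl_iff, mem_ball_zero_iff, not_lt]
        exact hN y hy
    _ ≤ ∫⁻ y in ⋃ c : t, Metric.ball (x + c) 1, F y := lintegral_mono_set hcov
    _ ≤ ∑' c : t, ∫⁻ y in Metric.ball (x + (c : EuclideanSpace ℝ (Fin n))) 1, F y :=
        lintegral_iUnion_le _ _
    _ ≤ ∑' _ : t, truncModular p f N := ENNReal.tsum_le_tsum fun c =>
        le_iSup (fun x : EuclideanSpace ℝ (Fin n) => ∫⁻ y in Metric.ball x 1, F y) (x + c)
    _ = t.card * truncModular p f N := by
        rw [tsum_fintype, Finset.sum_const, Finset.card_univ, Fintype.card_coe, nsmul_eq_mul]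

/-- The truncation property forces the modulars at a fixed radius to vanish as the centre of the
ball goes to infinity. -/
lemma tendsto_iSup_modular_far (hp : 0 < p) {f : EuclideanSpace ℝ (Fin n) → ℂ}
    (hf : VanishesStar p f) {R : ℝ} (hR : 0 < R) :
    Tendsto (fun N : ℕ => ⨆ (x : EuclideanSpace ℝ (Fin n)) (_ : (N : ℝ) ≤ ‖x‖ + 1),
      modular p lam f x R ^ (1 / p)) atTop (𝓝 0) := by
  obtain ⟨m, hm⟩ := exists_lintegral_ball_le_truncModular n p R
  obtain ⟨j, hj⟩ := exists_nat_ge (R + 1)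
  have h1 : Tendsto (fun N : ℕ =>
      (m * truncModular p f (N - j) / ENNReal.ofReal (R ^ lam)) ^ (1 / p)) atTop (𝓝 0) := by
    refine tendsto_rpow_const_zero (by positivity) ?_
    have h2 : Tendsto (fun N : ℕ => truncModular p f (N - j)) atTop (𝓝 0) :=
      Tendsto.comp (g := truncModular p f) hf (tendsto_sub_atTop_nat j)
    have h3 := ENNReal.Tendsto.const_mul h2 (Or.inr (ENNReal.natCast_ne_top m))
    have h4 := ENNReal.Tendsto.div_const (b := ENNReal.ofReal (R ^ lam)) h3
      (Or.inr (by rw [Ne, ENNReal.ofReal_eq_zero, not_le]; positivity))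
    simpa using h4
  refine tendsto_of_tendsto_of_tendsto_of_le_of_le tendsto_const_nhds h1 (fun _ => zero_le)
    fun N => iSup₂_le fun x hx => ?_
  refine ENNReal.rpow_le_rpow (ENNReal.div_le_div_right (hm f x (N - j) fun y hy => ?_) _)
    (by positivity)
  rcases le_total N j with h | h
  · simp [Nat.sub_eq_zero_of_le h]
  · rw [Nat.cast_sub h]
    rw [mem_ball_iff_norm'] at hy
    have := norm_le_norm_add_norm_sub' x y
    linarith

/-- The truncation property is inherited: a unit ball that meets the complement of `B(0, N)` has
its centre at distance at least `N - 1` from the origin. -/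
lemma VanishesStar.of_modular_le (hp : 0 < p) (hlam : lam < n)
    {f g : EuclideanSpace ℝ (Fin n) → ℂ} (hf : morreyNorm p lam f < ∞) {C : ℝ≥0∞} (hC : C ≠ ∞)
    (hfg : ∀ (x : EuclideanSpace ℝ (Fin n)) (r : ℝ), 0 < r →
      modular p lam g x r ^ (1 / p) ≤ C * dyadicSum p lam f x r)
    (hvan : VanishesStar p f) : VanishesStar p g := by
  have h1 : Tendsto (fun N : ℕ => ∑' k : ℕ, dyadicRatio n p lam ^ k *
      ⨆ (x : EuclideanSpace ℝ (Fin n)) (_ : (N : ℝ) ≤ ‖x‖ + 1),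
        modular p lam f x (2 ^ k * 1) ^ (1 / p)) atTop (𝓝 0) := by
    refine tendsto_tsum_mul_zero (tsum_dyadicRatio_ne_top hp hlam) hf.ne
      (Eventually.of_forall fun N k => iSup₂_le fun x _ =>
        modular_rpow_le_morreyNorm f x (by positivity))
      fun k => tendsto_iSup_modular_far hp hvan (by positivity)
  have h2 := ENNReal.Tendsto.const_mul h1 (Or.inr hC)
  rw [mul_zero] at h2
  replace h2 := tendsto_rpow_const_zero hp h2
  refine tendsto_of_tendsto_of_tendsto_of_le_of_le tendsto_const_nhds h2 (fun _ => zero_le)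
    fun N => iSup_le fun x => ?_
  by_cases hx : (N : ℝ) ≤ ‖x‖ + 1
  · have h3 : ∫⁻ y in Metric.ball x 1,
        (Metric.ball (0 : EuclideanSpace ℝ (Fin n)) (N : ℝ))ᶜ.indicator (fun z => ‖g z‖ₑ ^ p) y ≤
        modular p lam g x 1 := by
      rw [modular, Real.one_rpow, ENNReal.ofReal_one, div_one]
      exact lintegral_mono fun y => indicator_le_self _ _ y
    refine h3.trans ?_
    rw [← ENNReal.rpow_inv_le_iff hp, ← one_div]
    refine (hfg x 1 one_pos).trans ?_
    rw [dyadicSum]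
    refine mul_le_mul_right (ENNReal.tsum_le_tsum fun k => mul_le_mul_right ?_ _) _
    exact le_iSup₂ (f := fun (x : EuclideanSpace ℝ (Fin n)) (_ : (N : ℝ) ≤ ‖x‖ + 1) =>
      modular p lam f x (2 ^ k * 1) ^ (1 / p)) x hx
  · refine le_of_eq_of_le ?_ zero_le
    rw [setLIntegral_congr_fun (g := fun _ => 0) measurableSet_ball, lintegral_zero]
    intro y hy
    refine indicator_of_notMem ?_ _
    rw [mem_compl_iff, not_not, mem_ball_zero_iff]
    rw [mem_ball_iff_norm] at hy
    have := norm_le_norm_add_norm_sub x y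
    have := norm_le_norm_add_norm_sub' y x
    linarith

end VanishingMorrey

/-! ### Boundedness on the vanishing Morrey space -/

theorem mainTheorem7 (n : ℕ) (p lam : ℝ) (hp : 1 < p) (hlam : 0 ≤ lam) (hlam_lt : lam < n)
    (K : EuclideanSpace ℝ (Fin n) → EuclideanSpace ℝ (Fin n) → ℂ)
    (hK_meas : AEStronglyMeasurable
      (fun z : EuclideanSpace ℝ (Fin n) × EuclideanSpace ℝ (Fin n) => K z.1 z.2)
      (volume.prod volume))
    (hK_size : ∃ c : ℝ, ∀ x y : EuclideanSpace ℝ (Fin n), x ≠ y → ‖K x y‖ ≤ c / ‖x - y‖ ^ n)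
    (hK_Lp : VanishingMorrey.SingularIntegralBoundedOn K
      (fun f => MemLp f (ENNReal.ofReal p) volume)
      (fun f => eLpNorm f (ENNReal.ofReal p) volume)) :
    VanishingMorrey.SingularIntegralBoundedOn K
      (VanishingMorrey.MemVZeroInftyStar p lam)
      (VanishingMorrey.morreyNorm p lam) := by
  open VanishingMorrey in
  have hp0 : 0 < p := by linarith
  obtain ⟨C, hC, hmain⟩ :=
    exists_modular_singularIntegral_le hp hlam_lt hK_meas hK_size hK_Lp
  have hCq : C * ∑' k : ℕ, dyadicRatio n p lam ^ k ≠ ∞ :=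
    ENNReal.mul_ne_top hC (tsum_dyadicRatio_ne_top hp0 hlam_lt)
  refine ⟨(C * ∑' k : ℕ, dyadicRatio n p lam ^ k).toNNReal, fun f hf => ?_⟩
  obtain ⟨⟨hfM, hf0⟩, ⟨-, hfinf⟩, ⟨-, hfstar⟩⟩ := hf
  obtain ⟨hex, hle⟩ := hmain f hfM
  have hnorm : morreyNorm p lam (singularIntegral K f) ≤
      (C * ∑' k : ℕ, dyadicRatio n p lam ^ k) * morreyNorm p lam f := by
    refine iSup_le fun x => iSup₂_le fun r hr => (hle x r hr).trans ?_
    rw [mul_assoc]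
    exact mul_le_mul_right (dyadicSum_le f x hr) _
  have hmem : MemMorrey p lam (singularIntegral K f) :=
    ⟨aestronglyMeasurable_singularIntegral hK_meas hfM.1 hex,
      hnorm.trans_lt (ENNReal.mul_lt_top hCq.lt_top hfM.2)⟩
  refine ⟨hex, ⟨⟨hmem, ?_⟩, ⟨hmem, ?_⟩, ⟨hmem, ?_⟩⟩, ?_⟩
  · refine tendsto_iSup_modular_zero hp0 hlam_lt hfM.2 hC hle self_mem_nhdsWithin
      (fun k => ?_) hf0
    refine tendsto_nhdsWithin_iff.2 ⟨?_, ?_⟩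
    · have : Tendsto (fun r : ℝ => 2 ^ k * r) (𝓝 0) (𝓝 (2 ^ k * 0)) :=
        (continuous_const.mul continuous_id).tendsto 0
      rw [mul_zero] at this
      exact this.mono_left nhdsWithin_le_nhds
    · filter_upwards [self_mem_nhdsWithin] with r hr
      have hr' : (0 : ℝ) < r := hr
      exact mem_Ioi.2 (by positivity)
  · refine tendsto_iSup_modular_zero hp0 hlam_lt hfM.2 hC hle (eventually_gt_atTop (0 : ℝ))
      (fun k => ?_) hfinf
    have h2k : (0 : ℝ) < 2 ^ k := by positivity
    exact tendsto_id.const_mul_atTop h2k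
  · exact hfstar.of_modular_le hp0 hlam_lt hfM.2 hC hle
  · rwa [ENNReal.coe_toNNReal hCq]
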